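/- Let $n,m,r\ge 0$ be integers with $n+m\ge 1$, let $e_1,\dots,e_n,f_1,\dots,f_m$ be positive integers, and let $$H:\ F:=x_1^{e_1}\cdots x_n^{e_n}-y_1^{f_1}\cdots y_m^{f_m}=0\ \subset\ \mathbb A^{n+m+r}_{\mathbb C}$$ be the binomial hypersurface in the affine space with coordinates $x_1,\dots,x_n,y_1,\dots,y_m,z_1,\dots,z_r$ (an empty product is $1$). Let $w=x_1\cdots x_n\,y_1\cdots y_m\,z_1\cdots z_r$ and let $t=x_1^{e_1}\cdots x_n^{e_n}=y_1^{f_1}\cdots y_m^{f_m}\in\mathbb C[H]$. Then the pair $(H,\ D(w)-D(t))$ is log canonical. Here $H$ may be reducible and non-normal. For $g\in\mathbb C[H]$, $D(g)$ denotes the section $\mathcal O_H\to\mathcal O_H$ given by multiplication by $g$. That $(H,\Delta)$ with $\Delta=\sum_g a_gD(g)$, $a_g\in\mathbb Z$, is a pair means that $H$ is a reduced hypersurface and that every $g$ with $a_g\neq 0$ is nonzero at every generic point of $H$; this is part of the assertion. By adjunction $\omega_H=\omega_{\mathbb A}(H)|_H$ is free, generated by the Poincaré residue $\eta$ of $dX_1\wedge\cdots\wedge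 dX_N/F$, where $X_1,\dots,X_N$ are all the coordinates, $N=n+m+r$. Let $\mu:\widetilde X\to H$ be a resolution of singularities ($\widetilde X$ nonsingular, $\mu$ proper and an isomorphism over a dense open subset of $H$ with dense preimage) and $E$ a prime divisor on $\widetilde X$. The discrepancy $a(E,H,\Delta)$ is the order along $E$ of the rational section $\mu^*\bigl(\eta\prod_g g^{-a_g}\bigr)$ of $\omega_{\widetilde X}$. The pair is log canonical if $a(E,H,\Delta)\ge -1$ for every such $\mu$ and every such $E$, exceptional or not. -/

import Mathlib

open CategoryTheory AlgebraicGeometry MvPolynomial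
open scoped KaehlerDifferential

noncomputable section

/-! ### Hypersurfaces in affine space -/

namespace Hypersurface

/-- The coordinate ring `ℂ[X₀, …, X_d] / (F)` of the hypersurface `F = 0` in `𝔸^{d+1}`. -/
abbrev CoordRing {d : ℕ} (F : MvPolynomial (Fin (d + 1)) ℂ) : Type :=
  MvPolynomial (Fin (d + 1)) ℂ ⧸ Ideal.span {F}

/-- The hypersurface `H = {F = 0} ⊂ 𝔸^{d+1}`, as a scheme. -/
abbrev scheme {d : ℕ} (F : MvPolynomial (Fin (d + 1)) ℂ) : Scheme.{0} :=
  Spec (CommRingCat.of (CoordRing F))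

/-! ### Resolutions of singularities and prime divisors over a hypersurface -/

/-- `μ : X ⟶ H` is a resolution of singularities: it is proper, `X` is nonsingular, and `μ` is an
isomorphism over a dense open subset of `H` whose preimage is dense in `X`
(so `H` and `X` are allowed to have several irreducible components). -/
structure IsResolution {X H : Scheme.{0}} (μ : X ⟶ H) : Prop where
  proper : IsProper μ
  regular : ∀ x : X, IsRegularLocalRing (X.presheaf.stalk x)
  birational : ∃ U : H.Opens, Dense (U : Set H) ∧ Dense ((μ ⁻¹ᵁ U : X.Opens) : Set X) ∧
    IsIso (μ ∣_ U)

/-- A prime divisor `E` over the hypersurface `F = 0`: a resolution of singularities `μ : X ⟶ H`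
together with a point of codimension one of `X` (the generic point of `E`). -/
structure DivisorOver {d : ℕ} (F : MvPolynomial (Fin (d + 1)) ℂ) where
  X : Scheme.{0}
  μ : X ⟶ scheme F
  isResolution : IsResolution μ
  point : X
  codim_one : ringKrullDim (X.presheaf.stalk point) = 1

/-- A regular local ring of dimension one is a domain. -/
theorem isDomain_of_regular_of_dim_one (R : Type*) [CommRing R] [IsRegularLocalRing R]
    (h : ringKrullDim R = 1) : IsDomain R := by
  have h1 : (IsLocalRing.maximalIdeal R).spanFinrank = 1 := by
    have := (isRegularLocalRing_iff (R := R)).1 inferInstance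
    rw [h] at this
    exact_mod_cast this
  obtain ⟨π, hπ⟩ : ∃ π, IsLocalRing.maximalIdeal R = Ideal.span {π} := by
    have hfg := (IsNoetherian.noetherian (IsLocalRing.maximalIdeal R))
    have hc := hfg.generators_ncard
    rw [h1, Set.ncard_eq_one] at hc
    obtain ⟨π, hπ⟩ := hc
    refine ⟨π, ?_⟩
    have := (IsLocalRing.maximalIdeal R).span_generators
    rw [hπ] at this
    exact this.symm
  obtain ⟨p, hp, hlt⟩ : ∃ p : Ideal R, p.IsPrime ∧ p < IsLocalRing.maximalIdeal R := by
    by_contra! hcon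
    have : Ring.KrullDimLE 0 R := by
      refine Ring.krullDimLE_zero_iff.2 fun I hI => ?_
      have hle := IsLocalRing.le_maximalIdeal hI.ne_top
      have heq : I = IsLocalRing.maximalIdeal R := by
        by_contra hne
        exact hcon I hI (lt_of_le_of_ne hle hne)
      rw [heq]; infer_instance
    have h0 := Ring.krullDimLE_iff.1 this
    rw [h] at h0
    exact absurd h0 (by norm_num)
  have hπp : π ∉ p := fun hmem => hlt.not_ge (by
    rw [hπ, Ideal.span_le]; simpa using hmem)
  have hbot : p = ⊥ := by
    refine Submodule.eq_bot_of_le_smul_of_le_jacobson_bot (IsLocalRing.maximalIdeal R) p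
      (IsNoetherian.noetherian p) (fun x hx => ?_) (IsLocalRing.maximalIdeal_le_jacobson _)
    have hxm := hlt.le hx
    rw [hπ, Ideal.mem_span_singleton'] at hxm
    obtain ⟨a, rfl⟩ := hxm
    have ha : a ∈ p := (hp.mem_or_mem hx).resolve_right hπp
    rw [mul_comm]
    exact Submodule.smul_mem_smul (by rw [hπ]; exact Ideal.mem_span_singleton_self π) ha
  subst hbot
  exact IsDomain.of_bot_isPrime R

namespace DivisorOver

variable {d : ℕ} {F : MvPolynomial (Fin (d + 1)) ℂ}

/-- The local ring `𝒪_{X,E}` of `X` at the generic point of `E`. -/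
def LocalRing (E : DivisorOver F) : Type := E.X.presheaf.stalk E.point

instance (E : DivisorOver F) : CommRing E.LocalRing :=
  inferInstanceAs (CommRing (E.X.presheaf.stalk E.point))

instance (E : DivisorOver F) : IsRegularLocalRing E.LocalRing :=
  E.isResolution.regular E.point

instance (E : DivisorOver F) : IsDomain E.LocalRing :=
  isDomain_of_regular_of_dim_one E.LocalRing E.codim_one

/-- The pullback of regular functions along `μ`, from `ℂ[H]` to `𝒪_{X,E}`. -/
def pullback (E : DivisorOver F) : CoordRing F →+* E.LocalRing :=
  (E.X.presheaf.germ ⊤ E.point trivial).hom.comp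
    (E.μ.appTop.hom.comp (Scheme.ΓSpecIso (CommRingCat.of (CoordRing F))).inv.hom)

instance (E : DivisorOver F) : Algebra ℂ E.LocalRing :=
  (E.pullback.comp (algebraMap ℂ (CoordRing F))).toAlgebra


/-- The function field of the component of `X` which contains `E`. -/
abbrev FunctionField (E : DivisorOver F) : Type := FractionRing E.LocalRing

/-- The pullback to `X` of a polynomial on `𝔸^{d+1}`, as a rational function. -/
def pullbackPoly (E : DivisorOver F) : MvPolynomial (Fin (d + 1)) ℂ →+* E.FunctionField :=
  (algebraMap E.LocalRing E.FunctionField).comp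
    (E.pullback.comp (Ideal.Quotient.mk (Ideal.span {F})))

/-- Rational differential forms of degree `d` on the component of `X` which contains `E`. -/
abbrev RationalForm (E : DivisorOver F) : Type := ⋀[E.FunctionField]^d Ω[E.FunctionField⁄ℂ]

/-- The stalk at the generic point of `E` of the canonical sheaf `ω_X = Ω_X^d`, as a lattice in the
space of rational `d`-forms: the `𝒪_{X,E}`-module generated by the forms `da₁ ∧ ⋯ ∧ da_d` with
`aᵢ ∈ 𝒪_{X,E}`. -/
def canonicalStalk (E : DivisorOver F) : Submodule E.LocalRing E.RationalForm :=
  Submodule.span E.LocalRing (Set.range fun a : Fin d → E.LocalRing =>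
    exteriorPower.ιMulti E.FunctionField d fun i =>
      KaehlerDifferential.D ℂ E.FunctionField (algebraMap E.LocalRing E.FunctionField (a i)))

/-- The order `ord_E(ω)` along `E` of a rational section `ω` of `ω_X`: the largest `k` such that
`ω ∈ π^k ω_{X,E}`, with `π` a uniformizer of `𝒪_{X,E}` (and `⊤` for `ω = 0`). -/
def ord (E : DivisorOver F) (ω : E.RationalForm) : EReal :=
  ⨆ (k : ℤ) (_ : ∃ π : E.LocalRing, IsLocalRing.maximalIdeal E.LocalRing = Ideal.span {π} ∧
    ∃ ω₀ ∈ E.canonicalStalk, ω = (algebraMap E.LocalRing E.FunctionField π) ^ k • ω₀),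
    ((k : ℝ) : EReal)

/-! ### The canonical sheaf of a hypersurface, pairs and discrepancies -/

open scoped Classical in
/-- By adjunction, `ω_H = ω_{𝔸}(H)|_H` is free, generated by the Poincaré residue `η` of
`dX₀ ∧ ⋯ ∧ dX_d / F`; where `∂F/∂Xᵢ ≠ 0`, it is the form
`(-1)^i (∂F/∂Xᵢ)⁻¹ dX₀ ∧ ⋯ ∧ (omit dXᵢ) ∧ ⋯ ∧ dX_d`. This is the image of `η` under the canonical
rational map `μ^* ω_H ⇢ ω_X`, on the component of `X` which contains `E`. The choice of `i` is
irrelevant, see `pderiv_smul_residueForm`. -/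
def residueForm (E : DivisorOver F) : E.RationalForm :=
  if h : ∃ i, E.pullbackPoly (pderiv i F) ≠ 0 then
    ((-1) ^ (h.choose : ℕ) * (E.pullbackPoly (pderiv h.choose F))⁻¹) •
      exteriorPower.ιMulti E.FunctionField d fun j : Fin d =>
        KaehlerDifferential.D ℂ E.FunctionField (E.pullbackPoly (MvPolynomial.X (h.choose.succAbove j)))
  else 0

theorem pullbackPoly_C (E : DivisorOver F) (a : ℂ) :
    E.pullbackPoly (C a) = algebraMap ℂ E.FunctionField a := by
  rw [IsScalarTower.algebraMap_apply ℂ E.LocalRing E.FunctionField]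
  rfl

/-- The relation `∑ i, (∂F/∂Xᵢ) dXᵢ = 0` among differentials on `X`. -/
theorem sum_pderiv_smul_D (E : DivisorOver F) :
    ∑ i, E.pullbackPoly (pderiv i F) • KaehlerDifferential.D ℂ E.FunctionField
      (E.pullbackPoly (MvPolynomial.X i)) = 0 := by
  have key : ∀ g : MvPolynomial (Fin (d + 1)) ℂ,
      KaehlerDifferential.D ℂ E.FunctionField (E.pullbackPoly g) =
        ∑ i, E.pullbackPoly (pderiv i g) • KaehlerDifferential.D ℂ E.FunctionField
          (E.pullbackPoly (MvPolynomial.X i)) := by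
    intro g
    induction g using MvPolynomial.induction_on with
    | C a => simp [pullbackPoly_C]
    | add p q hp hq => simp [hp, hq, add_smul, Finset.sum_add_distrib]
    | mul_X p j hp =>
      simp only [map_mul, Derivation.leibniz, hp, smul_eq_mul, map_add, add_smul,
        Finset.sum_add_distrib, pderiv_X, mul_smul, ← Finset.smul_sum]
      congr 2
      rw [Finset.sum_eq_single j] <;> simp +contextual [eq_comm]
  rw [← key]
  have : E.pullbackPoly F = 0 := by
    have h0 : Ideal.Quotient.mk (Ideal.span {F}) F = 0 :=
      Ideal.Quotient.eq_zero_iff_mem.2 (Ideal.mem_span_singleton_self F)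
    simp [pullbackPoly, h0]
  rw [this, map_zero]

theorem smul_map_removeNth_eq {K M N : Type*} [Field K] [AddCommGroup M] [Module K M]
    [AddCommGroup N] [Module K N] {d : ℕ} (φ : M [⋀^Fin d]→ₗ[K] N) (v : Fin (d + 1) → M)
    (c : Fin (d + 1) → K) (h : ∑ i, c i • v i = 0) (i j : Fin (d + 1)) :
    ((-1) ^ (i : ℕ) * c j) • φ (i.removeNth v) = ((-1) ^ (j : ℕ) * c i) • φ (j.removeNth v) := by
  by_cases hij : i = j
  · subst hij; rfl
  obtain ⟨l, hl⟩ := Fin.exists_succAbove_eq (Ne.symm hij)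
  have hrem : ∀ u, i.removeNth (Function.update v j u) =
      Function.update (i.removeNth v) l u := by
    intro u
    rw [← hl]
    exact Fin.removeNth_update_succAbove i l u v
  have hsum : ∑ k, c k • φ (Function.update (i.removeNth v) l (v k)) = 0 := by
    have := congrArg (fun u => φ (Function.update (i.removeNth v) l u)) h
    simpa [AlternatingMap.map_update_sum, AlternatingMap.map_update_smul,
      AlternatingMap.map_update_zero] using this
  rw [Finset.sum_eq_add_of_mem j i (Finset.mem_univ _) (Finset.mem_univ _) (Ne.symm hij)] at hsum
  · have hj : Function.update (i.removeNth v) l (v j) = i.removeNth v := by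
      rw [← hrem, Function.update_eq_self]
    rw [hj, ← hrem] at hsum
    have h2 := AlternatingMap.neg_one_pow_smul_map_removeNth_add_eq_zero_of_eq φ
      (v := Function.update v j (v i)) (i := i) (j := j)
      (by simp [Function.update_of_ne hij]) hij
    rw [Fin.removeNth_update] at h2
    have h3 : c j • φ (i.removeNth v) =
        -(c i • φ (i.removeNth (Function.update v j (v i)))) := eq_neg_of_add_eq_zero_left hsum
    have h4 : ((-1 : K) ^ (i : ℕ)) • φ (i.removeNth (Function.update v j (v i))) =
        -(((-1 : K) ^ (j : ℕ)) • φ (j.removeNth v)) := by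
      have hc : ∀ (q : ℕ) (u : N), ((-1 : ℤ) ^ q) • u = ((-1 : K) ^ q) • u := fun q u => by
        rw [← Int.cast_smul_eq_zsmul K]; push_cast; rfl
      simp only [hc] at h2
      exact eq_neg_of_add_eq_zero_left h2
    rw [mul_smul, h3, smul_neg, smul_comm, h4, smul_neg, neg_neg, smul_smul, mul_comm]
  · intro k _ hk
    obtain ⟨q, hq⟩ := Fin.exists_succAbove_eq hk.2
    have hql : q ≠ l := by rintro rfl; exact hk.1 (hq.symm.trans hl)
    rw [φ.map_eq_zero_of_eq _ (i := l) (j := q) _ hql.symm, smul_zero]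
    simp [Function.update_of_ne hql, Fin.removeNth, hq]

/-- The residue form does not depend on the choice of a coordinate in its definition. -/
theorem pderiv_smul_residueForm (E : DivisorOver F) (i : Fin (d + 1))
    (h : ∃ k, E.pullbackPoly (pderiv k F) ≠ 0) :
    E.pullbackPoly (pderiv i F) • E.residueForm =
      (-1 : E.FunctionField) ^ (i : ℕ) • exteriorPower.ιMulti E.FunctionField d fun j : Fin d =>
        KaehlerDifferential.D ℂ E.FunctionField
          (E.pullbackPoly (MvPolynomial.X (i.succAbove j))) := by
  have hk := h.choose_spec
  rw [residueForm, dif_pos h]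
  generalize h.choose = k at hk ⊢
  have key := smul_map_removeNth_eq (exteriorPower.ιMulti E.FunctionField d
    (M := Ω[E.FunctionField⁄ℂ])) _ _ E.sum_pderiv_smul_D i k
  have key2 := congrArg (fun u => (E.pullbackPoly (pderiv k F))⁻¹ • u) key
  simp only [smul_smul] at key2 ⊢
  rw [mul_comm (_ ^ (i : ℕ)), inv_mul_cancel_left₀ hk] at key2
  refine Eq.trans ?_ key2.symm
  congr 1
  ring

/-- The discrepancy `a(E, H, Δ)` for a formal sum `Δ = ∑ a_g D(g)` of sections `𝒪_H → 𝒪_H`,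
multiplication by `g ∈ ℂ[H]`: the order along `E` of the rational section
`η · ∏ g^(-a_g)` of `ω_X`, the image of the generator of `ω_H(Δ)` under the canonical rational map
`μ^* ω_H(Δ) ⇢ ω_X`. -/
def discrepancy (E : DivisorOver F) (Δ : CoordRing F →₀ ℤ) : EReal :=
  E.ord ((Δ.prod fun g a => (algebraMap E.LocalRing E.FunctionField (E.pullback g)) ^ (-a)) •
    E.residueForm)

end DivisorOver

/-- `(H, Δ)` is a pair: `H = {F = 0}` is a hypersurface and reduced, and `Δ` is a formal sum of
sections which do not vanish at any generic point of `H`. -/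
structure IsPair {d : ℕ} (F : MvPolynomial (Fin (d + 1)) ℂ) (Δ : CoordRing F →₀ ℤ) : Prop where
  ne_zero : F ≠ 0
  reduced : IsReduced (CoordRing F)
  generically_ne_zero : ∀ g ∈ Δ.support, ∀ p ∈ minimalPrimes (CoordRing F), g ∉ p

/-- The pair `(H, Δ)` is log canonical: `a(E, H, Δ) ≥ -1` for every prime divisor `E` over `H`. -/
structure IsLogCanonical {d : ℕ} (F : MvPolynomial (Fin (d + 1)) ℂ) (Δ : CoordRing F →₀ ℤ) :
    Prop where
  isPair : IsPair F Δ
  neg_one_le_discrepancy : ∀ E : DivisorOver F, -1 ≤ E.discrepancy Δ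

end Hypersurface

end

/-!
The form `(t / w) η` is logarithmic. On the hypersurface `F = X^a - X^b`, with `a` and `b` of
disjoint support, both monomials equal `t`, so `Xᵢ ∂F/∂Xᵢ = (aᵢ - bᵢ) t` for every `i`. If
`aᵢ ≠ bᵢ`, computing the Poincaré residue `η` with respect to `Xᵢ` gives
`(t / w) η = ± (aᵢ - bᵢ)⁻¹ ⋀_{j ≠ i} dlog Xⱼ` (`inv_mul_smul_residueForm_binomial`).
In a discrete valuation ring with uniformizer `π`, every nonzero element is a unit times a power of
`π`, so its `dlog` is the sum of a regular form and a multiple of `dlog π`; since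
`dlog π ∧ dlog π = 0`, a wedge product of such forms has at most a simple pole
(`uniformizer_smul_wedge_dlog_mem`). This bounds the discrepancy at every prime divisor, exceptional
or not, by `-1` from below.

To carry this out on a resolution, the pullbacks of the coordinates have to be nonzero. No `Xₖ`
divides `F` (`not_X_dvd_binomial`), so the coordinates are nonzerodivisors on the hypersurface,
and a nonzerodivisor pulls back to a nonzero function on each component of a resolution
(`pullback_ne_zero`). Reducedness of the hypersurface follows from the same formula
for `Xᵢ ∂F/∂Xᵢ` (`squarefree_binomial`).
-/

noncomputable section

namespace Hypersurface

/-! ### Binomials in a polynomial ring -/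

/-- The binomial `X^a - X^b` with complex coefficients. -/
abbrev binomial {σ : Type*} (a b : σ →₀ ℕ) : MvPolynomial σ ℂ := monomial a 1 - monomial b 1

section Binomial

variable {σ : Type*} {a b : σ →₀ ℕ}

theorem not_X_dvd_binomial (hne : a ≠ b) (hd : ∀ k, a k = 0 ∨ b k = 0) (k : σ) :
    ¬ X k ∣ binomial a b := by
  classical
  rintro ⟨g, hg⟩
  have key : ∀ c : σ →₀ ℕ, c k = 0 →
      coeff c (binomial a b) = 0 := fun c hc => by
    rw [hg, mul_comm, coeff_mul_X', if_neg (by simpa using hc)]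
  -- One of the two monomials does not contain `X k`; a multiple of `X k` has no such monomial.
  rcases hd k with h | h
  · simpa [coeff_monomial, hne.symm] using key a h
  · simpa [coeff_monomial, hne] using key b h

theorem X_mul_pderiv_binomial (i : σ) :
    (X i : MvPolynomial σ ℂ) * pderiv i (binomial a b) =
      C ((a i : ℂ) - b i) * monomial a 1 + C (b i : ℂ) * binomial a b := by
  classical
  have key : ∀ c : σ →₀ ℕ,
      (X i : MvPolynomial σ ℂ) * pderiv i (monomial c 1) = C (c i : ℂ) * monomial c 1 := by
    intro c
    rw [X_mul_pderiv_monomial, nsmul_eq_mul, map_natCast]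
  rw [binomial, map_sub, mul_sub, key, key, map_sub]
  ring

/-- Let `F = X^a - X^b`. If an irreducible `p` satisfies `p² ∣ F`, then `p` divides
`Xᵢ ∂F/∂Xᵢ`, which for `aᵢ ≠ bᵢ` is a nonzero multiple of `X^a` modulo `F`. So `p` is associated to
a coordinate, but no coordinate divides `F`. -/
theorem squarefree_binomial (hne : a ≠ b) (hd : ∀ k, a k = 0 ∨ b k = 0) :
    Squarefree (binomial a b) := by
  obtain ⟨i, hi⟩ := DFunLike.ne_iff.1 hne
  have hF0 : binomial a b ≠ 0 := fun h =>
    not_X_dvd_binomial hne hd i (h ▸ dvd_zero _)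
  rw [squarefree_iff_irreducible_sq_not_dvd_of_ne_zero hF0]
  rintro p hp ⟨g, hg⟩
  have hpF : p ∣ binomial a b := ⟨p * g, by rw [hg, mul_assoc]⟩
  have hpd : p ∣ pderiv i (binomial a b) := by
    rw [hg, Derivation.leibniz, Derivation.leibniz]
    simp only [smul_eq_mul]
    exact ⟨p * pderiv i g + g * (pderiv i p + pderiv i p), by ring⟩
  have hpa : p ∣ (monomial a 1 : MvPolynomial σ ℂ) := by
    have h := (hpd.mul_left (X i)).sub (hpF.mul_left (C (b i : ℂ)))
    rw [X_mul_pderiv_binomial, add_sub_cancel_right] at h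
    have hu : IsUnit (C ((a i : ℂ) - b i) : MvPolynomial σ ℂ) :=
      (IsUnit.mk0 _ (sub_ne_zero.2 (by exact_mod_cast hi))).map C
    exact hu.dvd_mul_left.1 h
  rw [monomial_eq, map_one, one_mul, Finsupp.prod] at hpa
  obtain ⟨k, -, hk⟩ := hp.prime.exists_mem_finset_dvd hpa
  exact not_X_dvd_binomial hne hd k ((hp.dvd_symm X_prime.irreducible
    (hp.prime.dvd_of_dvd_pow hk)).trans hpF)

end Binomial

section Coordinates

variable {d : ℕ} {F : MvPolynomial (Fin (d + 1)) ℂ}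

theorem mk_mem_nonZeroDivisors_of_prime {q : MvPolynomial (Fin (d + 1)) ℂ} (hq : Prime q)
    (hqF : ¬ q ∣ F) :
    Ideal.Quotient.mk (Ideal.span {F}) q ∈ nonZeroDivisors (CoordRing F) := by
  rw [mem_nonZeroDivisors_iff_right]
  intro g hg
  obtain ⟨g, rfl⟩ := Ideal.Quotient.mk_surjective g
  rw [← map_mul, Ideal.Quotient.eq_zero_iff_mem, Ideal.mem_span_singleton] at hg
  rw [Ideal.Quotient.eq_zero_iff_mem, Ideal.mem_span_singleton]
  obtain ⟨h, hh⟩ := hg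
  obtain ⟨h', rfl⟩ : q ∣ h := (hq.dvd_or_dvd (Dvd.intro_left g hh)).resolve_left hqF
  exact ⟨h', mul_right_cancel₀ hq.ne_zero (by rw [hh]; ring)⟩

end Coordinates

/-! ### Nonvanishing of pulled back functions -/

namespace DivisorOver

variable {d : ℕ} {F : MvPolynomial (Fin (d + 1)) ℂ}

theorem germ_ne_zero_of_mem_nonZeroDivisors {A : Type} [CommRing A] {g : A}
    (hg : g ∈ nonZeroDivisors A) (q : Spec (CommRingCat.of A)) :
    (Spec (CommRingCat.of A)).presheaf.germ ⊤ q trivial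
      ((Scheme.ΓSpecIso (CommRingCat.of A)).inv.hom g) ≠ 0 := by
  let q' : PrimeSpectrum A := q
  have hloc : IsLocalization.AtPrime
      ((Spec.structureSheaf A).presheaf.stalk q') q'.asIdeal := inferInstance
  have hnt : Nontrivial ((Spec.structureSheaf A).presheaf.stalk q') :=
    IsLocalization.AtPrime.nontrivial _ q'.asIdeal
  intro h0
  have h1 : algebraMap A ((Spec.structureSheaf A).presheaf.stalk q') g = 0 := h0
  rw [IsLocalization.map_eq_zero_iff q'.asIdeal.primeCompl] at h1
  obtain ⟨c, hc⟩ := h1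
  have : (c : A) = 0 := (mem_nonZeroDivisors_iff_right.1 hg) c hc
  exact c.2 (this ▸ q'.asIdeal.zero_mem)

/-- A function vanishing at the generic point of `E` vanishes on an open subset of `X`, which meets
the locus where `μ` is an isomorphism; but a nonzerodivisor vanishes in no local ring of `H`. -/
theorem pullback_ne_zero (E : DivisorOver F) {g : CoordRing F}
    (hg : g ∈ nonZeroDivisors (CoordRing F)) : E.pullback g ≠ 0 := by
  intro h0
  obtain ⟨U, -, hdense, hiso⟩ := E.isResolution.birational
  set s := E.μ.appTop.hom ((Scheme.ΓSpecIso (CommRingCat.of (CoordRing F))).inv.hom g)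
  obtain ⟨V, hV, iV, iV', hres⟩ := TopCat.Presheaf.germ_eq (C := CommRingCat) E.X.presheaf
    E.point (U := ⊤) (V := ⊤) trivial trivial s 0 (by rw [map_zero]; exact h0)
  obtain ⟨q, hqV, hqU⟩ := hdense.inter_open_nonempty V V.isOpen ⟨_, hV⟩
  have hq : E.X.presheaf.germ ⊤ q trivial s = 0 := by
    rw [← TopCat.Presheaf.germ_res_apply E.X.presheaf iV q hqV, hres, map_zero, map_zero]
  have hst : IsIso (E.μ.stalkMap q) := by
    -- The stalk map of `μ` at `q` is that of its restriction over `U`.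
    have h1 : ∀ x, IsIso ((E.μ ∣_ U).stalkMap x) := fun x => inferInstance
    exact ((MorphismProperty.isomorphisms _).arrow_mk_iso_iff
      (morphismRestrictStalkMap E.μ U ⟨q, hqU⟩)).1 (h1 _)
  have hgerm := Scheme.Hom.germ_stalkMap_apply E.μ ⊤ q trivial
    ((Scheme.ΓSpecIso (CommRingCat.of (CoordRing F))).inv.hom g)
  refine germ_ne_zero_of_mem_nonZeroDivisors hg (E.μ q) ?_
  apply (ConcreteCategory.bijective_of_isIso (E.μ.stalkMap q)).1
  rw [map_zero]
  exact hgerm.trans hq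

end DivisorOver

/-! ### Wedge products of logarithmic differentials -/

section LogForms

variable {R K : Type*} [CommRing R] [IsDomain R] [IsDiscreteValuationRing R] [Field K]
  [Algebra R K] [IsFractionRing R K] [Algebra ℂ K] {d : ℕ}

/-- `dlog a₁ ∧ ⋯ ∧ dlog a_d` has at most a simple pole: writing `aⱼ = uⱼ π^{kⱼ}` with units `uⱼ`,
it expands into wedge products of the forms `dlog uⱼ` and `dlog π`, in which `dlog π` occurs at
most once. -/
theorem uniformizer_smul_wedge_dlog_mem {π : R} (hπ : Irreducible π) (a : Fin d → R)
    (ha : ∀ j, a j ≠ 0) :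
    (algebraMap R K π * ∏ j, (algebraMap R K (a j))⁻¹) •
      exteriorPower.ιMulti K d (fun j => KaehlerDifferential.D ℂ K (algebraMap R K (a j))) ∈
    Submodule.span R (Set.range fun a : Fin d → R =>
      exteriorPower.ιMulti K d fun i =>
        KaehlerDifferential.D ℂ K (algebraMap R K (a i))) := by
  classical
  choose k u hu using fun j => IsDiscreteValuationRing.eq_unit_mul_pow_irreducible (ha j) hπ
  set L := Submodule.span R (Set.range fun a : Fin d → R =>
      exteriorPower.ιMulti K d fun i =>
        KaehlerDifferential.D ℂ K (algebraMap R K (a i)))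
  have hπ0 : algebraMap R K π ≠ 0 := by simpa using hπ.ne_zero
  have hu0 : ∀ j, algebraMap R K (u j : R) ≠ 0 := fun j => by simp
  have hlog : ∀ j, (algebraMap R K (a j))⁻¹ • KaehlerDifferential.D ℂ K (algebraMap R K (a j)) =
      algebraMap R K ((u j)⁻¹ : Rˣ) • KaehlerDifferential.D ℂ K (algebraMap R K (u j)) +
        ((k j : K) * (algebraMap R K π)⁻¹) • KaehlerDifferential.D ℂ K (algebraMap R K π) := by
    intro j
    have hinv : algebraMap R K ((u j)⁻¹ : Rˣ) = (algebraMap R K (u j))⁻¹ :=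
      eq_inv_of_mul_eq_one_left (by rw [← map_mul, Units.inv_mul, map_one])
    have hpow : (k j : K) * algebraMap R K π ^ (k j - 1) =
        (k j : K) * (algebraMap R K π)⁻¹ * algebraMap R K π ^ k j := by
      -- The truncated exponent `k j - 1` is harmless: for `k j = 0` both sides vanish.
      rcases Nat.eq_zero_or_pos (k j) with h | h
      · simp [h]
      · obtain ⟨l, hl⟩ := Nat.exists_eq_add_of_lt h
        rw [hl]
        simp only [zero_add, Nat.add_sub_cancel, pow_succ]
        field_simp
    rw [hinv, hu j, map_mul, map_pow, Derivation.leibniz, Derivation.leibniz_pow,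
      ← Nat.cast_smul_eq_nsmul K, smul_add, add_comm]
    simp only [smul_smul]
    have hpk := pow_ne_zero (k j) hπ0
    congr 2
    · rw [mul_inv, mul_assoc, inv_mul_cancel₀ hpk, mul_one]
    · rw [hpow]
      field_simp [hu0 j]
  -- The terms of the expansion: `dlog uⱼ` in the slots `s`, multiples of `dlog π` in the others.
  let β : Finset (Fin d) → Fin d → K := fun s j =>
    if j ∈ s then algebraMap R K ((u j)⁻¹ : Rˣ) else (k j : K) * (algebraMap R K π)⁻¹
  let γ : Finset (Fin d) → Fin d → R := fun s j => if j ∈ s then u j else π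
  have hterm : ∀ s : Finset (Fin d), algebraMap R K π • exteriorPower.ιMulti K d (fun j =>
      β s j • KaehlerDifferential.D ℂ K (algebraMap R K (γ s j))) ∈ L := by
    intro s
    rw [AlternatingMap.map_smul_univ, smul_smul]
    by_cases hs : ∃ i j, i ∉ s ∧ j ∉ s ∧ i ≠ j
    -- Two slots with `dlog π` kill the term.
    · obtain ⟨i, j, hi, hj, hij⟩ := hs
      rw [AlternatingMap.map_eq_zero_of_eq _ _ (i := i) (j := j) _ hij, smul_zero]
      · exact L.zero_mem
      · simp [γ, hi, hj]
    -- With at most one such slot, `π` clears the denominator.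
    · obtain ⟨c, hc⟩ : ∃ c : R, algebraMap R K c = algebraMap R K π * ∏ j, β s j := by
        by_cases hs' : ∃ i, i ∉ s
        · obtain ⟨i, hi⟩ := hs'
          refine ⟨k i * ∏ j ∈ Finset.univ.erase i, (((u j)⁻¹ : Rˣ) : R), ?_⟩
          rw [← Finset.mul_prod_erase _ _ (Finset.mem_univ i), map_mul, map_prod, map_natCast]
          have h1 : β s i = (k i : K) * (algebraMap R K π)⁻¹ := if_neg hi
          have h2 : ∏ j ∈ Finset.univ.erase i, β s j =
              ∏ j ∈ Finset.univ.erase i, algebraMap R K ((u j)⁻¹ : Rˣ) := by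
            refine Finset.prod_congr rfl fun j hj => if_pos ?_
            by_contra hjs
            exact hs ⟨i, j, hi, hjs, (Finset.ne_of_mem_erase hj).symm⟩
          rw [h1, h2]
          field_simp
        · push Not at hs'
          refine ⟨π * ∏ j, (((u j)⁻¹ : Rˣ) : R), ?_⟩
          rw [map_mul, map_prod]
          exact congrArg _ (Finset.prod_congr rfl fun j _ => (if_pos (hs' j)).symm)
      rw [← hc, algebraMap_smul]
      exact L.smul_mem _ (Submodule.subset_span ⟨γ s, rfl⟩)
  rw [mul_smul, ← AlternatingMap.map_smul_univ]
  simp only [hlog]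
  have hadd := (exteriorPower.ιMulti K d (M := Ω[K⁄ℂ])).toMultilinearMap.map_add_univ
    (fun j => algebraMap R K ((u j)⁻¹ : Rˣ) • KaehlerDifferential.D ℂ K (algebraMap R K (u j)))
    (fun j => ((k j : K) * (algebraMap R K π)⁻¹) • KaehlerDifferential.D ℂ K (algebraMap R K π))
  refine (congrArg (fun ω => algebraMap R K π • ω ∈ L) hadd).mpr ?_
  rw [Finset.smul_sum]
  refine L.sum_mem fun s _ => ?_
  refine (congrArg (fun v => algebraMap R K π • exteriorPower.ιMulti K d v ∈ L)
    (funext fun j => ?_)).mpr (hterm s)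
  by_cases hj : j ∈ s <;> simp [β, γ, hj]

end LogForms

/-! ### Discrepancies -/

namespace DivisorOver

variable {d : ℕ} {F : MvPolynomial (Fin (d + 1)) ℂ}

instance (E : DivisorOver F) : IsDiscreteValuationRing E.LocalRing := by
  have hdim : ringKrullDim E.LocalRing = 1 := E.codim_one
  have hfield : ¬ IsField E.LocalRing := fun h => by
    rw [ringKrullDim_eq_zero_of_isField h] at hdim
    exact zero_ne_one hdim
  refine ((IsDiscreteValuationRing.TFAE E.LocalRing hfield).out 5 0).1 ?_
  have h := (IsRegularLocalRing.iff_finrank_cotangentSpace E.LocalRing).1 inferInstance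
  rw [hdim] at h
  exact_mod_cast h

theorem neg_one_le_ord (E : DivisorOver F) {π : E.LocalRing} (hπ : Irreducible π)
    {ω : E.RationalForm}
    (h : algebraMap E.LocalRing E.FunctionField π • ω ∈ E.canonicalStalk) : -1 ≤ E.ord ω := by
  have hπ0 : algebraMap E.LocalRing E.FunctionField π ≠ 0 := by simpa using hπ.ne_zero
  refine le_trans ?_ (le_iSup₂ (f := fun (k : ℤ) _ => ((k : ℝ) : EReal)) (-1 : ℤ)
    ⟨π, hπ.maximalIdeal_eq, _, h, ?_⟩)
  · norm_num
  · rw [zpow_neg_one, inv_smul_smul₀ hπ0]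

end DivisorOver

/-- Here `w = t` is allowed; both sides are then `1`. -/
theorem prod_single_sub_single {A K : Type*} [Field K] (φ : A → K) {w t : A} (hw : φ w ≠ 0) :
    ((Finsupp.single w 1 - Finsupp.single t 1 : A →₀ ℤ).prod fun g c => φ g ^ (-c)) =
      (φ w)⁻¹ * φ t := by
  classical
  by_cases hwt : w = t
  · subst hwt
    simp [inv_mul_cancel₀ hw]
  · rw [sub_eq_add_neg, ← Finsupp.single_neg, Finsupp.prod_add_index_of_disjoint]
    · rw [Finsupp.prod_single_index (by simp), Finsupp.prod_single_index (by simp)]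
      simp
    · simpa [Finsupp.support_single] using hwt

section Binomial

variable {d : ℕ} {a b : Fin (d + 1) →₀ ℕ}

theorem mk_X_mem_nonZeroDivisors (hne : a ≠ b) (hd : ∀ k, a k = 0 ∨ b k = 0) (k : Fin (d + 1)) :
    Ideal.Quotient.mk _ (X k) ∈ nonZeroDivisors (CoordRing (binomial a b)) :=
  mk_mem_nonZeroDivisors_of_prime X_prime (not_X_dvd_binomial hne hd k)

theorem mk_prod_X_mem_nonZeroDivisors (hne : a ≠ b) (hd : ∀ k, a k = 0 ∨ b k = 0) :
    Ideal.Quotient.mk _ (∏ k, X k) ∈ nonZeroDivisors (CoordRing (binomial a b)) := by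
  rw [map_prod]
  exact Submonoid.prod_mem _ fun k _ => mk_X_mem_nonZeroDivisors hne hd k

theorem mk_monomial_mem_nonZeroDivisors (hne : a ≠ b) (hd : ∀ k, a k = 0 ∨ b k = 0) :
    Ideal.Quotient.mk _ (monomial a 1) ∈ nonZeroDivisors (CoordRing (binomial a b)) := by
  rw [monomial_eq, map_one, one_mul, Finsupp.prod, map_prod]
  refine Submonoid.prod_mem _ fun k _ => ?_
  rw [map_pow]
  exact Submonoid.pow_mem _ (mk_X_mem_nonZeroDivisors hne hd k) _

theorem isPair_binomial (hne : a ≠ b) (hd : ∀ k, a k = 0 ∨ b k = 0) :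
    IsPair (binomial a b)
      (Finsupp.single (Ideal.Quotient.mk _ (∏ k, X k)) 1 -
        Finsupp.single (Ideal.Quotient.mk _ (monomial a 1)) 1) := by
  classical
  refine ⟨fun h0 => not_X_dvd_binomial hne hd 0 (h0 ▸ dvd_zero _),
    (Ideal.isRadical_iff_quotient_reduced _).1
      (isRadical_iff_span_singleton.1 (squarefree_binomial hne hd).isRadical),
    fun g hg p hp hgp => notMem_nonZeroDivisors_of_mem_mem_minimalPrimes hgp hp ?_⟩
  rcases Finset.mem_union.1 (Finsupp.support_sub hg) with h | h
  · rw [Finset.mem_singleton.1 (Finsupp.support_single_subset h)]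
    exact mk_prod_X_mem_nonZeroDivisors hne hd
  · rw [Finset.mem_singleton.1 (Finsupp.support_single_subset h)]
    exact mk_monomial_mem_nonZeroDivisors hne hd

namespace DivisorOver

theorem pullbackPoly_ne_zero {F : MvPolynomial (Fin (d + 1)) ℂ} (E : DivisorOver F)
    {q : MvPolynomial (Fin (d + 1)) ℂ}
    (hq : Ideal.Quotient.mk _ q ∈ nonZeroDivisors (CoordRing F)) : E.pullbackPoly q ≠ 0 :=
  (map_ne_zero_iff _ (IsFractionRing.injective E.LocalRing E.FunctionField)).2
    (E.pullback_ne_zero hq)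

theorem pullbackPoly_X_mul_pderiv_binomial (E : DivisorOver (binomial a b)) (i : Fin (d + 1)) :
    E.pullbackPoly (MvPolynomial.X i) * E.pullbackPoly (pderiv i (binomial a b)) =
      algebraMap ℂ E.FunctionField ((a i : ℂ) - b i) * E.pullbackPoly (monomial a 1) := by
  have hF : E.pullbackPoly (binomial a b) = 0 := by
    have h0 : Ideal.Quotient.mk (Ideal.span {binomial a b}) (binomial a b) = 0 :=
      Ideal.Quotient.eq_zero_iff_mem.2 (Ideal.mem_span_singleton_self _)
    rw [pullbackPoly, RingHom.comp_apply, RingHom.comp_apply, h0, map_zero, map_zero]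
  have h := congrArg E.pullbackPoly (X_mul_pderiv_binomial (a := a) (b := b) i)
  rwa [map_mul, map_add, map_mul, map_mul, hF, mul_zero, add_zero, E.pullbackPoly_C] at h

/-- Multiplied by `t / w`, the residue form becomes a constant multiple of the wedge product of
the forms `dlog Xⱼ`, `j ≠ i`, for any `i` with `aᵢ ≠ bᵢ`. -/
theorem inv_mul_smul_residueForm_binomial (hne : a ≠ b) (hd : ∀ k, a k = 0 ∨ b k = 0)
    (E : DivisorOver (binomial a b)) {i : Fin (d + 1)} (hi : a i ≠ b i) :
    ((E.pullbackPoly (∏ k, MvPolynomial.X k))⁻¹ * E.pullbackPoly (monomial a 1)) • E.residueForm =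
      ((-1) ^ (i : ℕ) * algebraMap ℂ E.FunctionField ((a i : ℂ) - b i)⁻¹ *
          ∏ j, (E.pullbackPoly (MvPolynomial.X (i.succAbove j)))⁻¹) •
        exteriorPower.ιMulti E.FunctionField d fun j : Fin d =>
          KaehlerDifferential.D ℂ E.FunctionField
            (E.pullbackPoly (MvPolynomial.X (i.succAbove j))) := by
  have hc : algebraMap ℂ E.FunctionField ((a i : ℂ) - b i) ≠ 0 :=
    (map_ne_zero _).2 (sub_ne_zero.2 (by exact_mod_cast hi))
  have hx : ∀ k, E.pullbackPoly (MvPolynomial.X k) ≠ 0 := fun k =>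
    E.pullbackPoly_ne_zero (mk_X_mem_nonZeroDivisors hne hd k)
  have ht := E.pullbackPoly_ne_zero (mk_monomial_mem_nonZeroDivisors hne hd)
  have hpd := E.pullbackPoly_X_mul_pderiv_binomial i
  have hpd0 : E.pullbackPoly (pderiv i (binomial a b)) ≠ 0 :=
    right_ne_zero_of_mul (hpd ▸ mul_ne_zero hc ht)
  have ht' : E.pullbackPoly (monomial a 1) =
      (algebraMap ℂ E.FunctionField ((a i : ℂ) - b i))⁻¹ *
        (E.pullbackPoly (MvPolynomial.X i) * E.pullbackPoly (pderiv i (binomial a b))) := by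
    rw [hpd, inv_mul_cancel_left₀ hc]
  have hxs : ∏ j, E.pullbackPoly (MvPolynomial.X (i.succAbove j)) ≠ 0 :=
    Finset.prod_ne_zero_iff.2 fun j _ => hx _
  have hη := congrArg (fun ω => (E.pullbackPoly (pderiv i (binomial a b)))⁻¹ • ω)
    (E.pderiv_smul_residueForm i ⟨i, hpd0⟩)
  simp only [inv_smul_smul₀ hpd0] at hη
  have hxi := hx i
  rw [hη, smul_smul, smul_smul, ht', map_prod, Fin.prod_univ_succAbove _ i,
    Finset.prod_inv_distrib, map_inv₀]
  congr 1
  field_simp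

end DivisorOver

/-- The pair `(H, D(w) - D(t))` for a binomial `X^a - X^b` in exponent-vector form, where `w` is the
product of all coordinates and `t = X^a`. -/
theorem isLogCanonical_binomial (hne : a ≠ b) (hd : ∀ k, a k = 0 ∨ b k = 0) :
    IsLogCanonical (binomial a b)
      (Finsupp.single (Ideal.Quotient.mk _ (∏ k, X k)) 1 -
        Finsupp.single (Ideal.Quotient.mk _ (monomial a 1)) 1) := by
  refine ⟨isPair_binomial hne hd, fun E => ?_⟩
  obtain ⟨i, hi⟩ := DFunLike.ne_iff.1 hne
  obtain ⟨π, hπ⟩ := IsDiscreteValuationRing.exists_irreducible E.LocalRing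
  refine E.neg_one_le_ord hπ ?_
  rw [prod_single_sub_single (fun g => algebraMap E.LocalRing E.FunctionField (E.pullback g))
    (E.pullbackPoly_ne_zero (mk_prod_X_mem_nonZeroDivisors hne hd))]
  refine (congrArg (fun ω => algebraMap E.LocalRing E.FunctionField π • ω ∈ E.canonicalStalk)
    (E.inv_mul_smul_residueForm_binomial hne hd hi)).mpr ?_
  have hmem := E.canonicalStalk.smul_mem
    ((-1) ^ (i : ℕ) * algebraMap ℂ E.LocalRing ((a i : ℂ) - b i)⁻¹)
    (uniformizer_smul_wedge_dlog_mem (K := E.FunctionField) hπ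
      (fun j => E.pullback (Ideal.Quotient.mk _ (X (i.succAbove j))))
      (fun j => E.pullback_ne_zero (mk_X_mem_nonZeroDivisors hne hd _)))
  rw [← algebraMap_smul E.FunctionField, smul_smul, map_mul, map_pow, map_neg, map_one,
    ← IsScalarTower.algebraMap_apply, mul_left_comm] at hmem
  rw [smul_smul]
  exact hmem

end Binomial

end Hypersurface

theorem mainTheorem2 {n m r d : ℕ} (hnm : 0 < n + m)
    (coord : Fin n ⊕ Fin m ⊕ Fin r ≃ Fin (d + 1))
    (e : Fin n → ℕ) (f : Fin m → ℕ) (he : ∀ i, 0 < e i) (hf : ∀ j, 0 < f j)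
    (x : Fin n → MvPolynomial (Fin (d + 1)) ℂ)
    (hx : ∀ i, x i = MvPolynomial.X (coord (Sum.inl i)))
    (y : Fin m → MvPolynomial (Fin (d + 1)) ℂ)
    (hy : ∀ j, y j = MvPolynomial.X (coord (Sum.inr (Sum.inl j))))
    (z : Fin r → MvPolynomial (Fin (d + 1)) ℂ)
    (hz : ∀ k, z k = MvPolynomial.X (coord (Sum.inr (Sum.inr k))))
    (F : MvPolynomial (Fin (d + 1)) ℂ)
    (hF : F = ∏ i, x i ^ e i - ∏ j, y j ^ f j)
    (w t : Hypersurface.CoordRing F)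
    (hw : w = Ideal.Quotient.mk _ ((∏ i, x i) * (∏ j, y j) * ∏ k, z k))
    (ht : t = Ideal.Quotient.mk _ (∏ i, x i ^ e i)) :
    Hypersurface.IsLogCanonical F (Finsupp.single w 1 - Finsupp.single t 1) := by
  classical
  -- The exponent vectors of the two monomials, indexed by all coordinates.
  let g : Fin n ⊕ Fin m ⊕ Fin r → ℕ := Sum.elim e fun _ => 0
  let h : Fin n ⊕ Fin m ⊕ Fin r → ℕ := Sum.elim (fun _ => 0) (Sum.elim f fun _ => 0)
  let a : Fin (d + 1) →₀ ℕ := Finsupp.equivFunOnFinite.symm fun k => g (coord.symm k)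
  let b : Fin (d + 1) →₀ ℕ := Finsupp.equivFunOnFinite.symm fun k => h (coord.symm k)
  have hmon : ∀ v : Fin n ⊕ Fin m ⊕ Fin r → ℕ,
      (monomial (Finsupp.equivFunOnFinite.symm fun k => v (coord.symm k)) 1 :
        MvPolynomial (Fin (d + 1)) ℂ) = ∏ l, X (coord l) ^ v l := fun v => by
    rw [monomial_eq, map_one, one_mul, Finsupp.prod_fintype _ _ (fun _ => pow_zero _),
      ← coord.prod_comp]
    simp
  have ha : (∏ i, x i ^ e i) = monomial a 1 := by
    rw [hmon g]; simp [g, Fintype.prod_sum_type, hx]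
  have hb : (∏ j, y j ^ f j) = monomial b 1 := by
    rw [hmon h]; simp [h, Fintype.prod_sum_type, hy]
  have hprod : (∏ i, x i) * (∏ j, y j) * ∏ k, z k = ∏ k, X k := by
    rw [← coord.prod_comp]; simp [Fintype.prod_sum_type, hx, hy, hz, mul_assoc]
  have hne : a ≠ b := fun hab => by
    have hgh : ∀ l, g l = h l := fun l => by
      simpa [a, b] using DFunLike.congr_fun hab (coord l)
    rcases Nat.add_pos_iff_pos_or_pos.1 hnm with hn | hm
    · exact (he ⟨0, hn⟩).ne' (hgh (Sum.inl ⟨0, hn⟩))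
    · exact (hf ⟨0, hm⟩).ne (hgh (Sum.inr (Sum.inl ⟨0, hm⟩)))
  have hd : ∀ k, a k = 0 ∨ b k = 0 := fun k => by
    rcases hk : coord.symm k with i | j | l <;> simp [a, b, g, h, hk]
  rw [ha, hb] at hF
  subst hF hw ht
  rw [hprod, ha]
  exact Hypersurface.isLogCanonical_binomial hne hd
end
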